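/- Let $H$ be a complex Hilbert space (not necessarily separable), let $M,N\subseteq H$ be closed subspaces with orthogonal projections $P,Q$ respectively, and write $Q^\perp=\mathbf 1-Q$. Assume that $P-Q$ is a Hilbert–Schmidt operator. Then both $Q(P-Q)Q$ and $Q^\perp(P-Q)Q^\perp$ are trace-class operators, both subspaces $M\cap N^\perp$ and $N\cap M^\perp$ are finite-dimensional, and $$\operatorname{trace}\bigl(Q(P-Q)Q+Q^\perp(P-Q)Q^\perp\bigr)=\dim(M\cap N^\perp)-\dim(N\cap M^\perp).$$ In particular, $QPQ+Q^\perp PQ^\perp-Q$ is a trace-class operator such that $$\operatorname{trace}(QPQ+Q^\perp PQ^\perp-Q)\in\mathbb Z.$$ -/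

import Mathlib

namespace HilbertOp

universe u

variable {H : Type u} [NormedAddCommGroup H] [InnerProductSpace ℂ H]

/-- `T` is Hilbert–Schmidt (`T ∈ 𝓛²`): `∑ ‖T eᵢ‖² < ∞` for some (equivalently, every)
orthonormal basis `(eᵢ)` of `H`. The basis may be uncountable. -/
def IsHilbertSchmidt (T : H →L[ℂ] H) : Prop :=
  ∃ (ι : Type u) (e : HilbertBasis ι ℂ H), Summable fun i => ‖T (e i)‖ ^ 2

/-- `T` is trace class (`T ∈ 𝓛¹`): `∑ ⟨|T| eᵢ, eᵢ⟩ < ∞` for every (equivalently, some)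
orthonormal basis `(eᵢ)` of `H`, where `|T| = (T* T)^(1/2)`. -/
def IsTraceClass [CompleteSpace H] (T : H →L[ℂ] H) : Prop :=
  ∀ (ι : Type u) (e : HilbertBasis ι ℂ H),
    Summable fun i => inner ℂ (e i) (CFC.abs T (e i))

/-- `T` is trace class and `trace T = z`: for every orthonormal basis `(eᵢ)` of `H` the series
`∑ ⟨T eᵢ, eᵢ⟩` converges unconditionally to `z`. Mathlib's inner product is linear in its second
argument. -/
def HasTrace [CompleteSpace H] (T : H →L[ℂ] H) (z : ℂ) : Prop :=
  IsTraceClass T ∧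
    ∀ (ι : Type u) (e : HilbertBasis ι ℂ H), HasSum (fun i => inner ℂ (e i) (T (e i))) z

/-- The trace is a well-defined number. -/
theorem HasTrace.unique [CompleteSpace H] {T : H →L[ℂ] H} {z w : ℂ}
    (hz : HasTrace T z) (hw : HasTrace T w) : z = w := by
  obtain ⟨s, e, -⟩ := exists_hilbertBasis ℂ H
  exact (hz.2 s e).unique (hw.2 s e)

end HilbertOp

/-! Put `A = P - Q` and `B = 1 - P - Q`. Then `A² + B² = 1`, `AB = -BA`, and the sum of the two
compressions is `A²(A + B)`. Anticommutation and cyclicity of the trace give `tr(A²B) = 0`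
(`diagSum_sq_mul_eq_zero`). They also kill `tr(A^(2n+3) B²)`, so `tr A^(2n+3)` is independent of `n`
(`diagSum_pow_odd_succ`). The odd powers of `A` converge strongly to the projection onto `M ∩ Nᗮ`
minus that onto `N ∩ Mᗮ` (`tendsto_sub_pow_apply`), and dominated convergence along the diagonal
identifies `tr A³` with the difference of dimensions. -/

open Filter Topology ContinuousLinearMap InnerProductSpace

namespace HilbertOp

universe u

variable {H : Type u} [NormedAddCommGroup H] [InnerProductSpace ℂ H]

/-! ### Hilbert bases and diagonal sums -/

/-- Parseval's identity for a Hilbert basis. -/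
theorem hasSum_norm_inner_sq {ι : Type*} (e : HilbertBasis ι ℂ H) (x : H) :
    HasSum (fun i => ‖inner ℂ (e i) x‖ ^ 2) (‖x‖ ^ 2) := by
  have h := (e.hasSum_inner_mul_inner x x).mapL Complex.reCLM
  convert! h using 1
  · ext i
    rw [Complex.reCLM_apply, ← inner_conj_symm x (e i), ← Complex.normSq_eq_conj_mul_self,
      Complex.ofReal_re, Complex.normSq_eq_norm_sq]
  · rw [Complex.reCLM_apply]
    exact (inner_self_eq_norm_sq (𝕜 := ℂ) x).symm

/-- `T` maps every Hilbert basis to a square-summable family. -/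
def SqSummable (T : H →L[ℂ] H) : Prop :=
  ∀ (ι : Type u) (e : HilbertBasis ι ℂ H), Summable fun i => ‖T (e i)‖ ^ 2

theorem summable_prod_norm_inner_sq {T : H →L[ℂ] H} {ι κ : Type*} (f : HilbertBasis κ ℂ H)
    {e : ι → H} (h : Summable fun i => ‖T (e i)‖ ^ 2) :
    Summable fun p : ι × κ => ‖inner ℂ (f p.2) (T (e p.1))‖ ^ 2 := by
  have h0 : 0 ≤ fun p : ι × κ => ‖inner ℂ (f p.2) (T (e p.1))‖ ^ 2 := fun p =>
    pow_nonneg (norm_nonneg _) 2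
  have h1 : ∀ i, Summable fun j => ‖inner ℂ (f j) (T (e i))‖ ^ 2 := fun i =>
    (hasSum_norm_inner_sq f _).summable
  have h2 : Summable fun i => ∑' j, ‖inner ℂ (f j) (T (e i))‖ ^ 2 :=
    h.congr fun i => (hasSum_norm_inner_sq f _).tsum_eq.symm
  exact (summable_prod_of_nonneg h0).mpr ⟨h1, h2⟩

theorem SqSummable.mul_left {T : H →L[ℂ] H} (h : SqSummable T) (X : H →L[ℂ] H) :
    SqSummable (X * T) := fun ι e =>
  .of_nonneg_of_le (fun i => by positivity)
    (fun i => by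
      rw [← mul_pow]
      exact pow_le_pow_left₀ (norm_nonneg _) (X.le_opNorm _) 2) ((h ι e).mul_left (‖X‖ ^ 2))

/-- The sum of the diagonal of `T` with respect to `e`. -/
noncomputable def diagSum {ι : Type*} (e : HilbertBasis ι ℂ H) (T : H →L[ℂ] H) : ℂ :=
  ∑' i, inner ℂ (e i) (T (e i))

theorem diagSum_neg {ι : Type*} (e : HilbertBasis ι ℂ H) (T : H →L[ℂ] H) :
    diagSum e (-T) = -diagSum e T := by
  simp [diagSum, tsum_neg]

/-- The diagonal of the projection onto a finite-dimensional subspace sums to its dimension. -/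
theorem hasSum_diag_starProjection {ι : Type*} (e : HilbertBasis ι ℂ H) (K : Submodule ℂ H)
    [FiniteDimensional ℂ K] :
    HasSum (fun i => inner ℂ (e i) (K.starProjection (e i))) (Module.finrank ℂ K : ℂ) := by
  set b := stdOrthonormalBasis ℂ K
  have h := hasSum_sum fun k (_ : k ∈ Finset.univ) =>
    e.hasSum_inner_mul_inner (b k : H) (b k : H)
  convert! h using 1
  · ext i
    rw [b.starProjection_eq_sum_rankOne, sum_apply, inner_sum]
    refine Finset.sum_congr rfl fun k _ => ?_
    simp [rankOne_apply, inner_smul_right]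
  · have : ∀ k, inner ℂ (b k : H) (b k : H) = 1 := fun k => by
      rw [← Submodule.coe_inner, inner_self_eq_norm_sq_to_K, b.orthonormal.1 k]; simp
    simp only [this, Finset.sum_const, Finset.card_univ, Fintype.card_fin, nsmul_eq_mul, mul_one]

/-! ### Hilbert–Schmidt operators and cyclicity of the trace -/

section HilbertSchmidt

variable [CompleteSpace H]

/-- The double family `|⟨f j, T (e i)⟩|²` can be summed over `i` first. Applied twice, this makes
the Hilbert–Schmidt condition independent of the basis. -/
theorem summable_adjoint_sq {T : H →L[ℂ] H} {ι κ : Type*} (f : HilbertBasis κ ℂ H)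
    (e : HilbertBasis ι ℂ H) (h : Summable fun i => ‖T (e i)‖ ^ 2) :
    Summable fun j => ‖star T (f j)‖ ^ 2 := by
  have h1 := ((Equiv.prodComm κ ι).summable_iff.mpr (summable_prod_norm_inner_sq f h)).prod
  refine h1.congr fun j => ?_
  rw [← (hasSum_norm_inner_sq e (star T (f j))).tsum_eq]
  refine tsum_congr fun i => ?_
  simp only [Function.comp_apply, Equiv.prodComm_apply, Prod.swap]
  rw [star_eq_adjoint, adjoint_inner_right, norm_inner_symm]

theorem IsHilbertSchmidt.sqSummable {T : H →L[ℂ] H} (h : IsHilbertSchmidt T) : SqSummable T := by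
  obtain ⟨ι, e, he⟩ := h
  intro κ f
  simpa using summable_adjoint_sq f f (summable_adjoint_sq f e he)

theorem SqSummable.adjoint {T : H →L[ℂ] H} (h : SqSummable T) : SqSummable (star T) :=
  fun ι e => summable_adjoint_sq e e (h ι e)

theorem SqSummable.mul_right {T : H →L[ℂ] H} (h : SqSummable T) (X : H →L[ℂ] H) :
    SqSummable (T * X) := by
  simpa using (h.adjoint.mul_left (star X)).adjoint

/-- For Hilbert–Schmidt `C`, `D`, the diagonal of `C D` is summable and its sum equals the
sum of the diagonal of `D C` with respect to any other basis. -/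
theorem SqSummable.hasSum_mul_comm {C D : H →L[ℂ] H} (hC : SqSummable C) (hD : SqSummable D)
    {ι κ : Type u} (e : HilbertBasis ι ℂ H) (f : HilbertBasis κ ℂ H) :
    HasSum (fun i => inner ℂ (e i) ((C * D) (e i)))
      (∑' j, inner ℂ (f j) ((D * C) (f j))) := by
  set F : ι × κ → ℂ := fun p =>
    inner ℂ (star C (e p.1)) (f p.2) * inner ℂ (f p.2) (D (e p.1)) with hF
  have hs : Summable F := by
    refine .of_norm_bounded
      ((summable_prod_norm_inner_sq f (hC.adjoint ι e)).add
        (summable_prod_norm_inner_sq f (hD ι e))) fun p => ?_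
    rw [hF, norm_mul, norm_inner_symm]
    nlinarith [sq_nonneg (‖inner ℂ (f p.2) (star C (e p.1))‖ - ‖inner ℂ (f p.2) (D (e p.1))‖),
      sq_nonneg (‖inner ℂ (f p.2) (star C (e p.1))‖), sq_nonneg ‖inner ℂ (f p.2) (D (e p.1))‖]
  have h1 : HasSum (fun i => inner ℂ (e i) ((C * D) (e i))) (∑' p, F p) := by
    refine hs.hasSum.prod_fiberwise fun i => ?_
    convert! f.hasSum_inner_mul_inner (star C (e i)) (D (e i)) using 1
    rw [star_eq_adjoint, adjoint_inner_left]
    rfl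
  have h2 : HasSum (fun j => inner ℂ (f j) ((D * C) (f j))) (∑' p, F p) := by
    have hs' := (Equiv.prodComm κ ι).hasSum_iff.mpr hs.hasSum
    refine hs'.prod_fiberwise fun j => ?_
    convert! e.hasSum_inner_mul_inner (star D (f j)) (C (f j)) using 1
    · ext i
      simp only [hF, Function.comp_apply, Equiv.prodComm_apply, Prod.swap, star_eq_adjoint,
        adjoint_inner_left, mul_comm]
    · rw [star_eq_adjoint, adjoint_inner_left]
      rfl
  rwa [h2.tsum_eq]

theorem diagSum_mul_comm {C D : H →L[ℂ] H} (hC : SqSummable C) (hD : SqSummable D)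
    {ι κ : Type u} (e : HilbertBasis ι ℂ H) (f : HilbertBasis κ ℂ H) :
    diagSum e (C * D) = diagSum f (D * C) :=
  (hC.hasSum_mul_comm hD e f).tsum_eq

theorem summable_diag {C D : H →L[ℂ] H} (hC : SqSummable C) (hD : SqSummable D)
    {ι : Type u} (e : HilbertBasis ι ℂ H) :
    Summable fun i => inner ℂ (e i) ((C * D) (e i)) :=
  (hC.hasSum_mul_comm hD e e).summable

/-- `X` is merely bounded: it is absorbed into `C`, then into `D`, so that each swap involves two
Hilbert–Schmidt factors. -/
theorem diagSum_mul_mul_comm {C D : H →L[ℂ] H} (hC : SqSummable C) (hD : SqSummable D)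
    (X : H →L[ℂ] H) {ι : Type u} (e : HilbertBasis ι ℂ H) :
    diagSum e (X * (C * D)) = diagSum e (C * D * X) := by
  rw [← mul_assoc, diagSum_mul_comm (hC.mul_left X) hD e e, ← mul_assoc,
    diagSum_mul_comm (hD.mul_right X) hC e e, mul_assoc]

/-- An operator whose modulus is `D⋆ D` with `D` Hilbert–Schmidt is trace class. -/
theorem SqSummable.isTraceClass {D T : H →L[ℂ] H} (hD : SqSummable D)
    (h : CFC.abs T = star D * D) : IsTraceClass T := by
  intro ι e
  rw [h]
  exact summable_diag hD.adjoint hD e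

theorem abs_star_mul_self (D : H →L[ℂ] H) : CFC.abs (star D * D) = star D * D :=
  CFC.abs_of_nonneg _ (star_mul_self_nonneg D)

theorem abs_eq_of_star_mul_self {T D : H →L[ℂ] H}
    (h : star T * T = star D * D * (star D * D)) : CFC.abs T = star D * D := by
  rw [CFC.abs, h, CFC.sqrt_mul_self _ (star_mul_self_nonneg D)]

/-- A closed subspace on which a Hilbert–Schmidt operator is isometric is finite-dimensional. -/
theorem SqSummable.finiteDimensional {T : H →L[ℂ] H} (hT : SqSummable T) (K : Submodule ℂ H)
    [CompleteSpace K] (hK : ∀ x ∈ K, ‖T x‖ = ‖x‖) : FiniteDimensional ℂ K := by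
  obtain ⟨w, b, hb⟩ := exists_hilbertBasis ℂ K
  have ho : Orthonormal ℂ (fun i : w => ((b i : K) : H)) :=
    b.orthonormal.comp_linearIsometry K.subtypeₗᵢ
  -- Once a basis of `K` is extended to one of `H`, each of its vectors contributes 1 to a
  -- convergent series.
  obtain ⟨w', b', hsub, hb'⟩ := ho.toSubtypeRange.exists_hilbertBasis_extension
  have hinj : Function.Injective (fun i : w => (⟨((b i : K) : H), hsub ⟨i, rfl⟩⟩ : w')) := by
    intro i j hij
    exact b.orthonormal.linearIndependent.injective (Subtype.ext (by simpa using hij))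
  have hs := (hT _ b').comp_injective hinj
  have hone : ∀ i : w, ‖T (b' (⟨((b i : K) : H), hsub ⟨i, rfl⟩⟩ : w'))‖ ^ 2 = 1 := by
    intro i
    rw [hb', hK _ (b i).2, ho.1 i, one_pow]
  have hs1 : Summable fun _ : w => (1 : ℝ) := hs.congr hone
  have hfin : Finite w := by
    by_contra hinf
    rw [not_finite_iff_infinite] at hinf
    exact one_ne_zero ((summable_const_iff _).mp hs1)
  have := Fintype.ofFinite w
  exact b.toOrthonormalBasis.toBasis.finiteDimensional_of_finite

end HilbertSchmidt

/-! ### Anticommuting self-adjoint pairs with `A² + B² = 1` -/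

section Anticommuting

variable [CompleteSpace H] {A B : H →L[ℂ] H}

theorem pow_odd_mul_of_anticommute {R : Type*} [Ring R] {a b : R} (h : a * b = -(b * a)) (n : ℕ) :
    a ^ (2 * n + 1) * b = -(b * a ^ (2 * n + 1)) := by
  have h2 : Commute (a ^ 2) b := by
    have : a * (a * b) = b * a * a := by rw [h, mul_neg, ← mul_assoc, h, neg_mul, neg_neg]
    rw [Commute, SemiconjBy, pow_two, mul_assoc, this, mul_assoc]
  have h3 : Commute (a ^ (2 * n)) b := by
    rw [pow_mul]; exact h2.pow_left n
  rw [pow_succ, mul_assoc, h, mul_neg, ← mul_assoc, h3.eq, mul_assoc]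

theorem norm_sq_add_norm_sq (hA : IsSelfAdjoint A) (hB : IsSelfAdjoint B)
    (hAB : A * A + B * B = 1) (x : H) : ‖A x‖ ^ 2 + ‖B x‖ ^ 2 = ‖x‖ ^ 2 := by
  have h : inner ℂ ((A * A + B * B) x) x = inner ℂ x x := by rw [hAB]; rfl
  rw [add_apply, inner_add_left] at h
  have h1 : inner ℂ ((A * A) x) x = inner ℂ (A x) (A x) := hA.isSymmetric (A x) x
  have h2 : inner ℂ ((B * B) x) x = inner ℂ (B x) (B x) := hB.isSymmetric (B x) x
  rw [h1, h2] at h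
  simp only [inner_self_eq_norm_sq_to_K] at h
  exact_mod_cast h

theorem norm_pow_apply_le (hA : IsSelfAdjoint A) (hB : IsSelfAdjoint B)
    (hAB : A * A + B * B = 1) (n : ℕ) (x : H) : ‖(A ^ n) x‖ ≤ ‖x‖ := by
  induction n with
  | zero => simp
  | succ n ih =>
    refine le_trans ?_ ih
    rw [pow_succ']
    have := norm_sq_add_norm_sq hA hB hAB ((A ^ n) x)
    change ‖A ((A ^ n) x)‖ ≤ _
    exact (pow_le_pow_iff_left₀ (norm_nonneg _) (norm_nonneg _) two_ne_zero).mp (by nlinarith [sq_nonneg ‖B ((A ^ n) x)‖])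

/-- `‖A^k z‖²` decreases with decrements `‖B A^k z‖²`, which therefore tend to zero; anticommutation
moves `B` to the right of the odd power. -/
theorem tendsto_pow_apply_of_range (hA : IsSelfAdjoint A) (hB : IsSelfAdjoint B)
    (hAB : A * A + B * B = 1) (hanti : A * B = -(B * A)) (z : H) :
    Tendsto (fun n : ℕ => (A ^ (2 * n + 1)) (B z)) atTop (𝓝 0) := by
  have hanti' : Antitone fun k : ℕ => ‖(A ^ k) z‖ ^ 2 := by
    refine antitone_nat_of_succ_le fun k => ?_
    have := norm_sq_add_norm_sq hA hB hAB ((A ^ k) z)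
    rw [pow_succ' A k]
    change ‖A ((A ^ k) z)‖ ^ 2 ≤ _
    nlinarith [sq_nonneg ‖B ((A ^ k) z)‖]
  obtain ⟨l, hl⟩ : ∃ l, Tendsto (fun k : ℕ => ‖(A ^ k) z‖ ^ 2) atTop (𝓝 l) :=
    ⟨_, tendsto_atTop_ciInf hanti' ⟨0, by rintro _ ⟨k, rfl⟩; positivity⟩⟩
  have hdiff : Tendsto (fun k : ℕ => ‖(A ^ k) z‖ ^ 2 - ‖(A ^ (k + 1)) z‖ ^ 2) atTop (𝓝 0) := by
    simpa using hl.sub (hl.comp (tendsto_add_atTop_nat 1))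
  have hB0 : Tendsto (fun k : ℕ => ‖B ((A ^ k) z)‖ ^ 2) atTop (𝓝 0) := by
    refine hdiff.congr fun k => ?_
    rw [← norm_sq_add_norm_sq hA hB hAB ((A ^ k) z), pow_succ' A k]
    exact add_sub_cancel_left _ _
  have hB1 : Tendsto (fun k : ℕ => ‖B ((A ^ k) z)‖) atTop (𝓝 0) := by
    simpa [Real.sqrt_sq] using hB0.sqrt
  rw [tendsto_zero_iff_norm_tendsto_zero]
  have h2 : Tendsto (fun n : ℕ => 2 * n + 1) atTop atTop :=
    tendsto_atTop_mono (fun n => by simp only [id]; omega) tendsto_id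
  refine (hB1.comp h2).congr fun n => ?_
  have := congrArg (fun T : H →L[ℂ] H => T z) (pow_odd_mul_of_anticommute hanti n)
  change (A ^ (2 * n + 1)) (B z) = -(B ((A ^ (2 * n + 1)) z)) at this
  rw [this, norm_neg]; rfl

/-- The odd powers of `A` converge strongly to zero on the orthogonal complement of `ker B`. -/
theorem tendsto_pow_apply_of_mem_orthogonal_ker (hA : IsSelfAdjoint A) (hB : IsSelfAdjoint B)
    (hAB : A * A + B * B = 1) (hanti : A * B = -(B * A)) {y : H} (hy : y ∈ (B.ker)ᗮ) :
    Tendsto (fun n : ℕ => (A ^ (2 * n + 1)) y) atTop (𝓝 0) := by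
  rw [B.orthogonal_ker, ← star_eq_adjoint, hB.star_eq] at hy
  have hy' : y ∈ closure (Set.range B) := hy
  rw [Metric.tendsto_atTop]
  intro ε hε
  obtain ⟨_, ⟨z, rfl⟩, hz⟩ := Metric.mem_closure_iff.mp hy' (ε / 2) (half_pos hε)
  obtain ⟨n₀, hn₀⟩ := Metric.tendsto_atTop.mp (tendsto_pow_apply_of_range hA hB hAB hanti z)
    (ε / 2) (half_pos hε)
  refine ⟨n₀, fun n hn => ?_⟩
  have h1 := hn₀ n hn
  have h2 := norm_pow_apply_le hA hB hAB (2 * n + 1) (y - B z)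
  rw [dist_zero_right] at h1 ⊢
  rw [dist_eq_norm] at hz
  calc ‖(A ^ (2 * n + 1)) y‖ = ‖(A ^ (2 * n + 1)) (y - B z) + (A ^ (2 * n + 1)) (B z)‖ := by
        rw [← map_add, sub_add_cancel]
    _ ≤ _ := norm_add_le _ _
    _ < ε := by linarith

theorem diagSum_pow_odd_succ (hA : SqSummable A) (hAB : A * A + B * B = 1)
    (hanti : A * B = -(B * A)) {ι : Type u} (e : HilbertBasis ι ℂ H) (n : ℕ) :
    diagSum e (A ^ (2 * (n + 1) + 3)) = diagSum e (A ^ (2 * n + 3)) := by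
  have hpow : ∀ m : ℕ, SqSummable (A ^ (m + 1)) := fun m => by
    rw [pow_succ]; exact hA.mul_left _
  have hz : diagSum e (A ^ (2 * n + 3) * B * B) = 0 := by
    -- One factor `A` is split off so that cyclicity applies to two Hilbert–Schmidt factors and the
    -- bounded `B`.
    have h1 := diagSum_mul_mul_comm hA ((hpow (2 * n + 1)).mul_right B) B e
    have h2 : A * (A ^ (2 * n + 1 + 1) * B) = A ^ (2 * n + 3) * B := by
      rw [← mul_assoc, ← pow_succ']
    have h3 := pow_odd_mul_of_anticommute hanti (n + 1)
    rw [show 2 * (n + 1) + 1 = 2 * n + 3 by ring] at h3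
    rw [h2] at h1
    have h4 : B * (A ^ (2 * n + 3) * B) = -(A ^ (2 * n + 3) * B * B) := by
      rw [← mul_assoc, ← neg_eq_iff_eq_neg.mpr h3, neg_mul]
    rw [h4, diagSum_neg] at h1
    exact self_eq_neg.mp h1.symm
  have hsplit : A ^ (2 * n + 3) = A ^ (2 * (n + 1) + 3) + A ^ (2 * n + 3) * B * B := by
    calc A ^ (2 * n + 3) = A ^ (2 * n + 3) * (A * A + B * B) := by rw [hAB, mul_one]
      _ = _ := by rw [mul_add, ← mul_assoc, ← mul_assoc, ← pow_succ, ← pow_succ]; rfl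
  have hs1 : Summable fun i => inner ℂ (e i) ((A ^ (2 * (n + 1) + 3)) (e i)) := by
    have := summable_diag hA (hpow (2 * n + 3)) e
    rwa [← pow_succ'] at this
  have hs2 : Summable fun i => inner ℂ (e i) ((A ^ (2 * n + 3) * B * B) (e i)) := by
    have := summable_diag hA (((hpow (2 * n + 1)).mul_right B).mul_right B) e
    rwa [← mul_assoc, ← mul_assoc, ← pow_succ'] at this
  have : diagSum e (A ^ (2 * n + 3)) = diagSum e (A ^ (2 * (n + 1) + 3))
      + diagSum e (A ^ (2 * n + 3) * B * B) := by
    conv_lhs => rw [hsplit]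
    simp only [diagSum, add_apply, inner_add_right]
    exact hs1.tsum_add hs2
  rw [this, hz, add_zero]

theorem diagSum_sq_mul_eq_zero (hA : SqSummable A) (hanti : A * B = -(B * A)) {ι : Type u}
    (e : HilbertBasis ι ℂ H) : diagSum e (A * A * B) = 0 := by
  have h1 := diagSum_mul_comm hA (hA.mul_right B) e e
  have h2 : A * B * A = -(A * A * B) := by
    rw [mul_assoc, mul_assoc, hanti, mul_neg, neg_neg]
  rw [h2, diagSum_neg, ← mul_assoc] at h1
  exact self_eq_neg.mp h1

/-- If the odd powers of `A` converge strongly to the difference of two finite-dimensional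
projections, then the trace of `A²(A + B)` is the difference of the dimensions. -/
theorem diagSum_sq_mul_add (hA : SqSummable A) (hAs : IsSelfAdjoint A) (hBs : IsSelfAdjoint B)
    (hAB : A * A + B * B = 1) (hanti : A * B = -(B * A)) (K L : Submodule ℂ H)
    [FiniteDimensional ℂ K] [FiniteDimensional ℂ L]
    (hlim : ∀ x, Tendsto (fun n : ℕ => (A ^ (2 * n + 1)) x) atTop
      (𝓝 (K.starProjection x - L.starProjection x)))
    {ι : Type u} (e : HilbertBasis ι ℂ H) :
    diagSum e (A * A * (A + B)) = (Module.finrank ℂ K : ℂ) - (Module.finrank ℂ L : ℂ) := by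
  have hs1 : Summable fun i => inner ℂ (e i) ((A * A * A) (e i)) :=
    summable_diag (hA.mul_left A) hA e
  have hs2 : Summable fun i => inner ℂ (e i) ((A * A * B) (e i)) := by
    simpa only [mul_assoc] using summable_diag hA (hA.mul_right B) e
  have h1 : diagSum e (A * A * (A + B)) = diagSum e (A ^ 3) := by
    have : diagSum e (A * A * (A + B)) = diagSum e (A * A * A) + diagSum e (A * A * B) := by
      simp only [diagSum, mul_add, add_apply, inner_add_right]
      exact hs1.tsum_add hs2
    rw [this, diagSum_sq_mul_eq_zero hA hanti, add_zero, pow_three, mul_assoc]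
  have hconst : ∀ n : ℕ, diagSum e (A ^ (2 * n + 3)) = diagSum e (A ^ 3) := by
    intro n
    induction n with
    | zero => rfl
    | succ n ih => rw [diagSum_pow_odd_succ hA hAB hanti, ih]
  have hP : HasSum (fun i => inner ℂ (e i) (K.starProjection (e i) - L.starProjection (e i)))
      ((Module.finrank ℂ K : ℂ) - (Module.finrank ℂ L : ℂ)) := by
    simpa only [inner_sub_right] using
      (hasSum_diag_starProjection e K).sub (hasSum_diag_starProjection e L)
  have hT : Tendsto (fun n : ℕ => diagSum e (A ^ (2 * n + 3))) atTop
      (𝓝 ((Module.finrank ℂ K : ℂ) - (Module.finrank ℂ L : ℂ))) := by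
    rw [← hP.tsum_eq]
    -- One `A` moved to each side of the inner product bounds the `i`-th term by `‖A (e i)‖²`,
    -- uniformly in `n`; hence the exponents `2n + 3`.
    refine tendsto_tsum_of_dominated_convergence (hA ι e) (fun i => ?_) (.of_forall fun n i => ?_)
    · have := (tendsto_const_nhds (x := e i)).inner (𝕜 := ℂ)
        ((hlim (e i)).comp (tendsto_add_atTop_nat 1))
      exact this
    · have : (A ^ (2 * n + 3)) (e i) = A ((A ^ (2 * n + 1)) (A (e i))) := by
        rw [pow_succ, pow_succ']; rfl
      rw [this, ← hAs.isSymmetric.apply_clm, pow_two]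
      exact (norm_inner_le_norm _ _).trans
        (mul_le_mul_of_nonneg_left (norm_pow_apply_le hAs hBs hAB _ _) (norm_nonneg _))
  rw [h1]
  refine tendsto_nhds_unique ?_ hT
  simp only [hconst]
  exact tendsto_const_nhds

end Anticommuting

/-! ### Algebra of two projections and the strong limit -/

section Projections

variable {R : Type*} [Ring R] {p q : R}

theorem sub_sq_add_one_sub_sub_sq (hp : p * p = p) (hq : q * q = q) :
    (p - q) * (p - q) + (1 - p - q) * (1 - p - q) = 1 := by
  simp only [mul_sub, sub_mul, mul_one, one_mul, hp, hq]; abel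

theorem sub_mul_one_sub_sub (hp : p * p = p) (hq : q * q = q) :
    (p - q) * (1 - p - q) = -((1 - p - q) * (p - q)) := by
  simp only [mul_sub, sub_mul, mul_one, one_mul, hp, hq]; abel

/-- For projections the right side is `-(AQ)⋆(AQ)` with `A = p - q`, so the modulus of the
compression is explicit. -/
theorem compress_eq_neg (hp : p * p = p) (hq : q * q = q) :
    q * (p - q) * q = -(q * (p - q) * ((p - q) * q)) := by
  have h2 : q * (p * (p * q)) = q * (p * q) := by rw [← mul_assoc p, hp]
  simp only [mul_sub, sub_mul, mul_assoc, hq, h2]; abel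

theorem compress_one_sub_eq (hp : p * p = p) (hq : q * q = q) :
    (1 - q) * (p - q) * (1 - q) = (1 - q) * (p - q) * ((p - q) * (1 - q)) := by
  have h2 : p * (p * q) = p * q := by rw [← mul_assoc p, hp]
  simp only [mul_sub, sub_mul, mul_assoc, mul_one, one_mul, hp, hq, h2]; abel

theorem compress_add_compress (hp : p * p = p) (hq : q * q = q) :
    q * (p - q) * q + (1 - q) * (p - q) * (1 - q) =
      (p - q) * (p - q) * (p - q + (1 - p - q)) := by
  simp only [mul_sub, mul_add, sub_mul, mul_assoc, mul_one, one_mul, hp, hq]; abel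

theorem compress_sub_eq (hq : q * q = q) :
    q * p * q + (1 - q) * p * (1 - q) - q =
      q * (p - q) * q + (1 - q) * (p - q) * (1 - q) := by
  simp only [mul_sub, sub_mul, mul_assoc, mul_one, one_mul, hq]; abel

theorem sub_sq_commute (hp : p * p = p) (hq : q * q = q) :
    Commute ((p - q) * (p - q)) q := by
  have h1 : q * (q * p) = q * p := by rw [← mul_assoc, hq]
  rw [Commute, SemiconjBy]
  simp only [mul_sub, sub_mul, mul_assoc, hp, hq, h1]; abel

end Projections

variable (M N : Submodule ℂ H) [M.HasOrthogonalProjection]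
  [N.HasOrthogonalProjection]

theorem sub_apply_of_mem {M N : Submodule ℂ H} [M.HasOrthogonalProjection]
    [N.HasOrthogonalProjection] {x : H} (hx : x ∈ M ⊓ Nᗮ) :
    (M.starProjection - N.starProjection) x = x := by
  rw [sub_apply, M.starProjection_eq_self_iff.mpr hx.1,
    N.starProjection_apply_eq_zero_iff.mpr hx.2, sub_zero]

theorem sub_apply_of_mem' {M N : Submodule ℂ H} [M.HasOrthogonalProjection]
    [N.HasOrthogonalProjection] {x : H} (hx : x ∈ N ⊓ Mᗮ) :
    (M.starProjection - N.starProjection) x = -x := by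
  rw [← neg_sub, neg_apply, sub_apply_of_mem hx]

theorem mem_sup_of_add_eq {x : H}
    (hx : M.starProjection x + N.starProjection x = x) : x ∈ (M ⊓ Nᗮ) ⊔ (N ⊓ Mᗮ) := by
  have h1 : N.starProjection x = Mᗮ.starProjection x := by
    rw [M.starProjection_orthogonal_val]; exact eq_sub_of_add_eq' hx
  have h2 : M.starProjection x = Nᗮ.starProjection x := by
    rw [N.starProjection_orthogonal_val]; exact eq_sub_of_add_eq hx
  rw [← hx]
  refine Submodule.add_mem_sup ⟨M.starProjection_apply_mem x, ?_⟩
    ⟨N.starProjection_apply_mem x, ?_⟩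
  · rw [h2]; exact Submodule.starProjection_apply_mem _ x
  · rw [h1]; exact Submodule.starProjection_apply_mem _ x

variable [CompleteSpace H]

/-- The odd powers of a difference of two projections converge strongly to the difference of the
projections onto its eigenspaces for `1` and `-1`. -/
theorem tendsto_sub_pow_apply [(M ⊓ Nᗮ).HasOrthogonalProjection]
    [(N ⊓ Mᗮ).HasOrthogonalProjection] (x : H) :
    Tendsto (fun n : ℕ => ((M.starProjection - N.starProjection) ^ (2 * n + 1)) x) atTop
      (𝓝 ((M ⊓ Nᗮ).starProjection x - (N ⊓ Mᗮ).starProjection x)) := by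
  set A := M.starProjection - N.starProjection with hA
  set B := 1 - M.starProjection - N.starProjection with hB
  have hMi : M.starProjection * M.starProjection = M.starProjection :=
    M.isIdempotentElem_starProjection
  have hNi : N.starProjection * N.starProjection = N.starProjection :=
    N.isIdempotentElem_starProjection
  have hMs : IsSelfAdjoint M.starProjection := isSelfAdjoint_starProjection M
  have hNs : IsSelfAdjoint N.starProjection := isSelfAdjoint_starProjection N
  have hpow : ∀ n : ℕ, ∀ y ∈ M ⊓ Nᗮ, (A ^ (2 * n + 1)) y = y := by
    intro n y hy
    generalize 2 * n + 1 = m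
    induction m with
    | zero => rfl
    | succ m ih =>
      rw [pow_succ]
      change (A ^ m) (A y) = y
      rw [hA, sub_apply_of_mem hy, ← hA, ih]
  have hpow' : ∀ n : ℕ, ∀ y ∈ N ⊓ Mᗮ, (A ^ (2 * n + 1)) y = -y := by
    intro n y hy
    induction n with
    | zero =>
      rw [mul_zero, zero_add, pow_one]
      exact sub_apply_of_mem' hy
    | succ n ih =>
      rw [show 2 * (n + 1) + 1 = (2 * n + 1) + 1 + 1 by ring, pow_succ, pow_succ]
      change (A ^ (2 * n + 1)) (A (A y)) = -y
      rw [hA, sub_apply_of_mem' hy, map_neg, sub_apply_of_mem' hy, neg_neg, ← hA, ih]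
  set E := (M ⊓ Nᗮ).starProjection x with hE
  set F := (N ⊓ Mᗮ).starProjection x with hF
  have hEm : E ∈ M ⊓ Nᗮ := Submodule.starProjection_apply_mem _ x
  have hFm : F ∈ N ⊓ Mᗮ := Submodule.starProjection_apply_mem _ x
  have hw : x - E - F ∈ B.kerᗮ := by
    -- The kernel of `B` is spanned by the two eigenspaces, so removing both components of `x` lands
    -- in its orthogonal complement.
    have hle : B.ker ≤ (M ⊓ Nᗮ) ⊔ (N ⊓ Mᗮ) := fun y hy => by
      refine mem_sup_of_add_eq M N ?_
      have : y - M.starProjection y - N.starProjection y = 0 := hy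
      rw [sub_sub, sub_eq_zero] at this
      exact this.symm
    refine Submodule.orthogonal_le hle ?_
    rw [← Submodule.inf_orthogonal]
    refine ⟨sub_mem ((M ⊓ Nᗮ).sub_starProjection_mem_orthogonal x) ?_, ?_⟩
    · intro u hu
      exact Submodule.inner_left_of_mem_orthogonal hFm.1 hu.2
    · rw [sub_right_comm]
      refine sub_mem ((N ⊓ Mᗮ).sub_starProjection_mem_orthogonal x) ?_
      intro u hu
      exact Submodule.inner_left_of_mem_orthogonal hEm.1 hu.2
  have h0 := tendsto_pow_apply_of_mem_orthogonal_ker (hMs.sub hNs)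
    ((((IsSelfAdjoint.one (H →L[ℂ] H))).sub hMs).sub hNs)
    (sub_sq_add_one_sub_sub_sq hMi hNi) (sub_mul_one_sub_sub hMi hNi) hw
  have h1 := h0.add_const (E - F)
  rw [zero_add] at h1
  refine h1.congr fun n => ?_
  rw [map_sub, map_sub, hpow n E hEm, hpow' n F hFm]
  abel

end HilbertOp

/-! ### The theorem -/

open HilbertOp

theorem theorem4p1 {H : Type*} [NormedAddCommGroup H] [InnerProductSpace ℂ H] [CompleteSpace H]
    (M N : Submodule ℂ H) [M.HasOrthogonalProjection] [N.HasOrthogonalProjection]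
    (P Q : H →L[ℂ] H) (hP : P = M.starProjection) (hQ : Q = N.starProjection)
    (hPQ : HilbertOp.IsHilbertSchmidt (P - Q)) :
    HilbertOp.IsTraceClass (Q * (P - Q) * Q) ∧
    HilbertOp.IsTraceClass ((1 - Q) * (P - Q) * (1 - Q)) ∧
    FiniteDimensional ℂ ↥(M ⊓ Nᗮ) ∧
    FiniteDimensional ℂ ↥(N ⊓ Mᗮ) ∧
    HilbertOp.HasTrace (Q * (P - Q) * Q + (1 - Q) * (P - Q) * (1 - Q))
      ((Module.finrank ℂ ↥(M ⊓ Nᗮ) : ℂ) - (Module.finrank ℂ ↥(N ⊓ Mᗮ) : ℂ)) ∧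
    HilbertOp.IsTraceClass (Q * P * Q + (1 - Q) * P * (1 - Q) - Q) ∧
    ∃ k : ℤ, HilbertOp.HasTrace (Q * P * Q + (1 - Q) * P * (1 - Q) - Q) (k : ℂ) := by
  have hPi : P * P = P := hP ▸ M.isIdempotentElem_starProjection
  have hQi : Q * Q = Q := hQ ▸ N.isIdempotentElem_starProjection
  have hPs : IsSelfAdjoint P := hP ▸ isSelfAdjoint_starProjection M
  have hQs : IsSelfAdjoint Q := hQ ▸ isSelfAdjoint_starProjection N
  have hOs : IsSelfAdjoint (1 - Q) := (IsSelfAdjoint.one _).sub hQs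
  have hAs : IsSelfAdjoint (P - Q) := hPs.sub hQs
  have hBs : IsSelfAdjoint (1 - P - Q) := ((IsSelfAdjoint.one _).sub hPs).sub hQs
  have hA : SqSummable (P - Q) := hPQ.sqSummable
  have hcomp : ∀ X : H →L[ℂ] H, IsSelfAdjoint X →
      X * (P - Q) * ((P - Q) * X) = star ((P - Q) * X) * ((P - Q) * X) := fun X hX => by
    rw [star_mul, hX.star_eq, hAs.star_eq]
  have hMc : IsClosed ((M ⊓ Nᗮ : Submodule ℂ H) : Set H) :=
    (M.orthogonal_orthogonal ▸ Mᗮ.isClosed_orthogonal : IsClosed (M : Set H)).inter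
      N.isClosed_orthogonal
  have hNc : IsClosed ((N ⊓ Mᗮ : Submodule ℂ H) : Set H) :=
    (N.orthogonal_orthogonal ▸ Nᗮ.isClosed_orthogonal : IsClosed (N : Set H)).inter
      M.isClosed_orthogonal
  have := hMc.completeSpace_coe
  have := hNc.completeSpace_coe
  have hMf : FiniteDimensional ℂ ↥(M ⊓ Nᗮ) := hA.finiteDimensional _ fun x hx => by
    rw [hP, hQ, sub_apply_of_mem hx]
  have hNf : FiniteDimensional ℂ ↥(N ⊓ Mᗮ) := hA.finiteDimensional _ fun x hx => by
    rw [hP, hQ, sub_apply_of_mem' hx, norm_neg]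
  have hTr : HasTrace (Q * (P - Q) * Q + (1 - Q) * (P - Q) * (1 - Q))
      ((Module.finrank ℂ ↥(M ⊓ Nᗮ) : ℂ) - (Module.finrank ℂ ↥(N ⊓ Mᗮ) : ℂ)) := by
    rw [compress_add_compress hPi hQi]
    refine ⟨hA.isTraceClass (abs_eq_of_star_mul_self ?_), fun ι e => ?_⟩
    -- `A + B = 1 - 2Q` is a self-adjoint unitary commuting with `A²`, so the modulus of `A²(A + B)`
    -- is `A²`.
    · have hS : P - Q + (1 - P - Q) = 1 - Q - Q := by abel
      have hSS : (1 - Q - Q) * (1 - Q - Q) = 1 := by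
        simp only [mul_sub, sub_mul, mul_one, one_mul, hQi]; abel
      have hc : Commute ((P - Q) * (P - Q)) (1 - Q - Q) :=
        ((Commute.one_right _).sub_right (sub_sq_commute hPi hQi)).sub_right
          (sub_sq_commute hPi hQi)
      rw [hS, star_mul, star_mul, (hOs.sub hQs).star_eq, hAs.star_eq, hc.eq, mul_assoc,
        ← mul_assoc _ (1 - Q - Q), hc.eq, mul_assoc (1 - Q - Q), ← mul_assoc, hSS, one_mul]
    · rw [← diagSum_sq_mul_add hA hAs hBs (sub_sq_add_one_sub_sub_sq hPi hQi)
        (sub_mul_one_sub_sub hPi hQi) (M ⊓ Nᗮ) (N ⊓ Mᗮ)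
        (fun x => by rw [hP, hQ]; exact tendsto_sub_pow_apply M N x) e]
      refine Summable.hasSum ?_
      rw [mul_assoc]
      exact summable_diag hA (hA.mul_right _) e
  refine ⟨?_, ?_, hMf, hNf, hTr, ?_, ?_⟩
  · refine (hA.mul_right Q).isTraceClass ?_
    rw [compress_eq_neg hPi hQi, CFC.abs_neg, hcomp Q hQs, abs_star_mul_self]
  · refine (hA.mul_right (1 - Q)).isTraceClass ?_
    rw [compress_one_sub_eq hPi hQi, hcomp _ hOs, abs_star_mul_self]
  · rw [compress_sub_eq hQi]
    exact hTr.1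
  · refine ⟨(Module.finrank ℂ ↥(M ⊓ Nᗮ) : ℤ) - (Module.finrank ℂ ↥(N ⊓ Mᗮ) : ℤ), ?_⟩
    rw [compress_sub_eq hQi]
    push_cast
    exact hTr
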